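/- For an integer $a$ put $\mathrm{size}(a)=\lceil\log_2(|a|+1)\rceil$, and for a rational number $p=a/b$ in lowest terms ($b>0$) put $\mathrm{size}(p)=1+\mathrm{size}(a)+\mathrm{size}(b)$. The size of a rational linear inequality $W\equiv\bigl(\sum_{i\in I}u_ix_i\mathrel{\mathrm{op}}c\bigr)$ in the variables $x_i$ ($i\in I$, $I$ finite), with $u_i,c\in\mathbb{Q}$ and $\mathrm{op}\in\{<,\le,>,\ge\}$, is $|W|=1+|I|+\mathrm{size}(c)+\sum_{i\in I}\mathrm{size}(u_i)$. For integers $r_0,\dots,r_n$ and propositional variables $a_1,\dots,a_n$, let $\sum_{i=1}^n r_ia_i\ge r_0$ denote the propositional formula $$\bigwedge_{J\subseteq\{1,\dots,n\},\ \sum_{j\in J}r_j<r_0}\Bigl(\bigwedge_{j\in J}a_j\to\bigvee_{j\notin J}a_j\Bigr).$$ Let $n\ge 0$, and let $W$ be a rational linear inequality either in the variables $x_1,\dots,x_n$ (so that $I=\{1,\dots,n\}$ and $x_0$ is not constrained by $W$) or in the variables $x_0,\dots,x_n$ (so that $I=\{0,\dots,n\}$). Then for every solution $r_0,\dots,r_n\in\mathbb{Z}$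 of $W$ there exists a solution $s_0,\dots,s_n\in\mathbb{Z}$ of $W$ such that $\mathrm{sgn}(s_i)=\mathrm{sgn}(r_i)$ for all $i=0,\dots,n$, the propositional formulas $\sum_{i=1}^n s_ia_i\ge s_0$ and $\sum_{i=1}^n r_ia_i\ge r_0$ are propositionally equivalent, and $\mathrm{size}(s_i)\le 18|W|^4$ for all $i=0,\dots,n$. -/

import Mathlib

/-- Propositional formulas over a set `V` of propositional variables. -/
inductive PropForm (V : Type*) where
  | bot : PropForm V
  | var : V → PropForm V
  | neg : PropForm V → PropForm V
  | and : PropForm V → PropForm V → PropForm V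

namespace PropForm

variable {V : Type*}

/-- The constant true. -/
def top : PropForm V := neg bot

/-- Disjunction, defined from `¬` and `∧`. -/
def or (φ ψ : PropForm V) : PropForm V := neg (and (neg φ) (neg ψ))

/-- Implication, defined from `¬` and `∧`. -/
def imp (φ ψ : PropForm V) : PropForm V := neg (and φ (neg ψ))

/-- The conjunction of a finite list of formulas; the empty conjunction is `⊤`. -/
def listConj : List (PropForm V) → PropForm V
  | [] => top
  | φ :: l => and φ (listConj l)

/-- The disjunction of a finite list of formulas; the empty disjunction is `⊥`. -/
def listDisj : List (PropForm V) → PropForm V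
  | [] => bot
  | φ :: l => or φ (listDisj l)

/-- The conjunction of the formulas `f j` for `j ∈ s` (in some order). -/
noncomputable def bigConj {ι : Type*} (s : Finset ι) (f : ι → PropForm V) : PropForm V :=
  listConj (s.toList.map f)

/-- The disjunction of the formulas `f j` for `j ∈ s` (in some order). -/
noncomputable def bigDisj {ι : Type*} (s : Finset ι) (f : ι → PropForm V) : PropForm V :=
  listDisj (s.toList.map f)

/-- `κ ⊨ φ`: the valuation `κ` satisfies the formula `φ`. -/
def Sat (κ : V → Bool) : PropForm V → Prop
  | bot => False
  | var a => κ a = true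
  | neg φ => ¬ Sat κ φ
  | and φ ψ => Sat κ φ ∧ Sat κ ψ

/-- A propositional tautology. -/
def Tautology (φ : PropForm V) : Prop := ∀ κ : V → Bool, Sat κ φ

/-- `φ` propositionally entails `ψ`: the implication `φ → ψ` is a tautology. -/
def Entails (φ ψ : PropForm V) : Prop := Tautology (imp φ ψ)

/-- Propositional equivalence: mutual propositional entailment. -/
def Equivalent (φ ψ : PropForm V) : Prop := Entails φ ψ ∧ Entails ψ φ

/-- The propositional formula abbreviated by `∑ i, r i • φ i ≥ k`, that is,
`⋀_{J ⊆ I, r(J) < k} (⋀_{j ∈ J} φ j → ⋁_{j ∉ J} φ j)` where `r(J) = ∑ j ∈ J, r j`. -/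
noncomputable def sumGe {ι : Type*} [Fintype ι] [DecidableEq ι]
    (r : ι → ℤ) (φ : ι → PropForm V) (k : ℤ) : PropForm V :=
  bigConj ((Finset.univ : Finset (Finset ι)).filter fun J => ∑ j ∈ J, r j < k)
    fun J => imp (bigConj J φ) (bigDisj Jᶜ φ)

end PropForm

/-- The bit size of an integer: `⌈log₂ (|a| + 1)⌉`. -/
def intSize (a : ℤ) : ℕ := Nat.clog 2 (a.natAbs + 1)

/-- `intSize` agrees with the formula through the real logarithm. -/
theorem intSize_eq_ceil_logb (a : ℤ) : (intSize a : ℤ) = ⌈Real.logb 2 (|(a : ℝ)| + 1)⌉ := by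
  have h := Real.natCeil_logb_natCast 2 (a.natAbs + 1)
  unfold intSize
  rw [← h]
  push_cast
  rw [Nat.cast_natAbs]
  push_cast
  rw [Int.natCast_ceil_eq_ceil]
  exact Real.logb_nonneg (by norm_num) (by linarith [abs_nonneg (a : ℝ)])

/-- The bit size of a rational number `a / b` in lowest terms. -/
def ratSize (q : ℚ) : ℕ := 1 + intSize q.num + intSize (q.den : ℤ)

/-- The four comparison operators allowed in a linear inequality. -/
inductive CompOp where
  | lt
  | le
  | gt
  | ge

/-- The relation on rational numbers denoted by a comparison operator. -/
def CompOp.Rel : CompOp → ℚ → ℚ → Prop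
  | .lt, x, y => x < y
  | .le, x, y => x ≤ y
  | .gt, x, y => x > y
  | .ge, x, y => x ≥ y

/-- A rational linear inequality `∑ i, u i * x i op c` in variables `x i` indexed by `ι`. -/
structure RatIneq (ι : Type*) where
  /-- the coefficients -/
  coeff : ι → ℚ
  /-- the comparison operator -/
  op : CompOp
  /-- the constant on the right-hand side -/
  rhs : ℚ

namespace RatIneq

variable {ι : Type*} [Fintype ι]

/-- The integer vector `x` is a solution of the inequality. -/
def IsSol (W : RatIneq ι) (x : ι → ℤ) : Prop :=
  W.op.Rel (∑ i, W.coeff i * (x i : ℚ)) W.rhs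

/-- The size of a rational inequality: one plus the number of variables plus the sizes of all
the coefficients and of the right-hand side. -/
def size (W : RatIneq ι) : ℕ :=
  1 + Fintype.card ι + (ratSize W.rhs + ∑ i, ratSize (W.coeff i))

end RatIneq

/-! Truth of the formula under a valuation, the signs of the coordinates, and `W` with denominators
cleared are all decided by conditions `c ≤ a ⬝ᵥ z`, where `c` is small and `a` runs over a family of
small functionals: one per subset of the variables, the unit vectors, and the coefficients of `W`.
It suffices to find a small `s` that agrees with `r` on these conditions. Among the vectors agreeing
with `r`, take `s` with lexicographically least absolute values. If the functionals of moderate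
value at `s` did not span, Siegel's lemma would give a small nonzero `v` killed by all of them.
Adding `v` or `-v` alters only values too large to cross a level, and one of the two shrinks the
first coordinate where `v` is nonzero, a contradiction (`exists_bounded_agreeUpTo`). So these
functionals contain a nonsingular square system, and Cramer's rule bounds `s`. -/

/-! ### Small kernel vectors and Cramer bounds -/

section SmallKernelVectors

open Matrix

attribute [local instance] Matrix.normedAddCommGroup

/-- A form of Siegel's lemma with an integral exponent, which also allows an empty system. -/
theorem exists_small_mem_kernel {α β : Type*} [Fintype α] [Fintype β] (A : Matrix α β ℤ)
    (hcard : Fintype.card α < Fintype.card β) {x : ℕ} (hx : 1 ≤ x) (hA : ∀ i j, |A i j| ≤ x) :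
    ∃ v : β → ℤ, v ≠ 0 ∧ A *ᵥ v = 0 ∧
      ∀ j, |v j| ≤ ((Fintype.card β * x : ℕ) : ℤ) ^ Fintype.card β := by
  classical
  have hβ : 0 < Fintype.card β := by omega
  have hbase : 1 ≤ Fintype.card β * x := Nat.mul_pos hβ hx
  rcases Nat.eq_zero_or_pos (Fintype.card α) with h0 | hpos
  -- Siegel's lemma needs an equation; with none, a unit vector works.
  · have := Fintype.card_eq_zero_iff.mp h0
    obtain ⟨j₀⟩ := Fintype.card_pos_iff.mp hβ
    refine ⟨Pi.single j₀ 1, by simp, Subsingleton.elim _ _, fun j => ?_⟩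
    have h1 : (1 : ℤ) ≤ ((Fintype.card β * x : ℕ) : ℤ) ^ Fintype.card β :=
      one_le_pow₀ (by exact_mod_cast hbase)
    refine le_trans ?_ h1
    by_cases h : j = j₀
    · subst h; simp
    · simp [h]
  · obtain ⟨v, hv0, hv, hb⟩ := Int.Matrix.exists_ne_zero_int_vec_norm_le A hcard hpos
    refine ⟨v, hv0, hv, fun j => ?_⟩
    have hnorm : ‖A‖ ≤ x := by
      rw [Matrix.norm_le_iff (by positivity)]
      intro i j
      rw [Int.norm_eq_abs]
      exact_mod_cast hA i j
    have hmax : max 1 ‖A‖ ≤ (x : ℝ) := max_le (by exact_mod_cast hx) hnorm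
    have hβ' : (1 : ℝ) ≤ Fintype.card β := by exact_mod_cast hβ
    have hsub : (1 : ℝ) ≤ (Fintype.card β : ℝ) - Fintype.card α := by
      have : ((Fintype.card α + 1 : ℕ) : ℝ) ≤ Fintype.card β := by exact_mod_cast hcard
      push_cast at this
      linarith
    have hexp : (Fintype.card α : ℝ) / ((Fintype.card β : ℝ) - Fintype.card α)
        ≤ (Fintype.card β : ℝ) :=
      (div_le_self (by positivity) hsub).trans (by exact_mod_cast hcard.le)
    have hfinal : ‖v‖ ≤ ((Fintype.card β : ℝ) * x) ^ Fintype.card β := by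
      refine hb.trans ?_
      rw [← Real.rpow_natCast]
      have h1 : (1 : ℝ) ≤ Fintype.card β * max 1 ‖A‖ :=
        one_le_mul_of_one_le_of_one_le hβ' (le_max_left _ _)
      refine (Real.rpow_le_rpow_of_exponent_le h1 hexp).trans ?_
      exact Real.rpow_le_rpow (by linarith) (by gcongr) (by positivity)
    have := (norm_le_pi_norm v j).trans hfinal
    rw [Int.norm_eq_abs] at this
    exact_mod_cast this

/-- A bounded set of integer vectors either is annihilated by a small nonzero vector or contains
the rows of a nonsingular square matrix. -/
theorem exists_small_annihilator_or_nonsingular {ι : Type*} [Fintype ι] [DecidableEq ι]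
    (T : Set (ι → ℤ)) {x : ℕ} (hx : 1 ≤ x) (hT : ∀ a ∈ T, ∀ i, |a i| ≤ x) :
    (∃ v : ι → ℤ, v ≠ 0 ∧ (∀ a ∈ T, a ⬝ᵥ v = 0) ∧
      ∀ i, |v i| ≤ ((Fintype.card ι * x : ℕ) : ℤ) ^ Fintype.card ι) ∨
    ∃ M : Matrix ι ι ℤ, M.det ≠ 0 ∧ ∀ i, M i ∈ T := by
  let c : (ι → ℤ) → (ι → ℚ) := fun a i => (a i : ℚ)
  obtain ⟨b, hbT, hspan, hli⟩ := exists_linearIndependent ℚ (c '' T)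
  have : Finite b := hli.setFinite
  have : Fintype b := Fintype.ofFinite b
  have hle : Fintype.card b ≤ Fintype.card ι := by
    simpa using hli.fintype_card_le_finrank
  choose f hfT hfc using fun k : b => hbT k.2
  -- Deficient rank: a kernel vector of a basis of the span kills all of `T`. Full rank: the basis
  -- itself is the matrix.
  rcases hle.lt_or_eq with hlt | heq
  · left
    obtain ⟨v, hv0, hv, hb⟩ := exists_small_mem_kernel (Matrix.of f) hlt hx
      fun k i => hT _ (hfT k) i
    refine ⟨v, hv0, fun a ha => ?_, hb⟩
    have hcast : ∀ a : ι → ℤ, c a ⬝ᵥ c v = ((a ⬝ᵥ v : ℤ) : ℚ) := fun a => by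
      simp [c, dotProduct]
    have hmem : c a ∈ Submodule.span ℚ b := hspan ▸ Submodule.subset_span ⟨a, ha, rfl⟩
    have hzero : ∀ y ∈ Submodule.span ℚ b, y ⬝ᵥ c v = 0 := fun y hy => by
      induction hy using Submodule.span_induction with
      | mem y hy =>
        have hy' : c (f ⟨y, hy⟩) = y := hfc ⟨y, hy⟩
        rw [← hy', hcast]
        exact_mod_cast congrFun hv ⟨y, hy⟩
      | zero => simp
      | add y z _ _ h₁ h₂ => rw [add_dotProduct, h₁, h₂, add_zero]
      | smul q y _ h => rw [smul_dotProduct, h, smul_zero]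
    have := hzero _ hmem
    rw [hcast] at this
    exact_mod_cast this
  · right
    let e : ι ≃ b := Fintype.equivOfCardEq heq.symm
    refine ⟨Matrix.of fun i => f (e i), fun hdet => ?_, fun i => hfT (e i)⟩
    have hrow : LinearIndependent ℚ
        ((Matrix.of fun i => f (e i)).map (Int.cast : ℤ → ℚ)).row := by
      have : ((Matrix.of fun i => f (e i)).map (Int.cast : ℤ → ℚ)).row
          = ((↑) : b → ι → ℚ) ∘ e := by
        funext i
        exact hfc (e i)
      rw [this]
      exact hli.comp _ e.injective
    rw [Matrix.linearIndependent_rows_iff_isUnit, Matrix.isUnit_iff_isUnit_det] at hrow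
    have hd := Int.cast_det (R := ℚ) (Matrix.of fun i => f (e i))
    rw [hdet, Int.cast_zero] at hd
    rw [← hd] at hrow
    exact not_isUnit_zero hrow

/-- Cramer's rule as a bound: a nonsingular integer system with small data has a small solution. -/
theorem abs_le_of_mulVec_bounded {ι : Type*} [Fintype ι] [DecidableEq ι] (M : Matrix ι ι ℤ)
    (hdet : M.det ≠ 0) (s : ι → ℤ) {y : ℤ} (hM : ∀ i j, |M i j| ≤ y)
    (hs : ∀ i, |(M *ᵥ s) i| ≤ y) (i : ι) :
    |s i| ≤ (Fintype.card ι).factorial * y ^ Fintype.card ι := by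
  have hc : M.det * s i = (M.updateCol i (M *ᵥ s)).det := by
    rw [← Matrix.cramer_apply, Matrix.cramer_eq_adjugate_mulVec, Matrix.mulVec_mulVec,
      Matrix.adjugate_mul, Matrix.smul_mulVec, Matrix.one_mulVec]
    rfl
  have hb : |(M.updateCol i (M *ᵥ s)).det| ≤
      (Fintype.card ι).factorial • y ^ Fintype.card ι :=
    Matrix.det_le (abv := AbsoluteValue.abs) fun k j => by
      rw [AbsoluteValue.abs_apply, Matrix.updateCol_apply]
      split_ifs
      exacts [hs k, hM k j]
  rw [← hc, abs_mul, nsmul_eq_mul] at hb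
  have h1 : 1 ≤ |M.det| := Int.one_le_abs hdet
  nlinarith [abs_nonneg (s i)]

theorem abs_dotProduct_le {ι : Type*} [Fintype ι] {a v : ι → ℤ} {x y : ℤ}
    (ha : ∀ i, |a i| ≤ x) (hv : ∀ i, |v i| ≤ y) : |a ⬝ᵥ v| ≤ Fintype.card ι * (x * y) := by
  refine (Finset.abs_sum_le_sum_abs _ _).trans ?_
  refine (Finset.sum_le_card_nsmul _ _ (x * y) fun i _ => ?_).trans (by simp)
  rw [abs_mul]
  exact mul_le_mul (ha i) (hv i) (abs_nonneg _) ((abs_nonneg _).trans (ha i))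

end SmallKernelVectors

/-! ### Bounded integer points by lexicographic descent -/

section BoundedIntegerPoints

open Matrix

/-- Two integer vectors agree with respect to the functionals in `F` up to level `x` if no
inequality `a ⬝ᵥ z ≥ c` with `a ∈ F` and `|c| ≤ x` distinguishes them. -/
def AgreeUpTo {ι : Type*} [Fintype ι] (F : Set (ι → ℤ)) (x : ℤ) (s r : ι → ℤ) : Prop :=
  ∀ a ∈ F, ∀ c : ℤ, |c| ≤ x → (c ≤ a ⬝ᵥ s ↔ c ≤ a ⬝ᵥ r)

/-- The threshold beyond which the value of a functional counts as large. -/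
def largeThreshold (d x : ℕ) : ℤ := x + d * (x * ((d * x : ℕ) : ℤ) ^ d)

/-- A value within `x + θ` of zero is left unchanged; any other moves by at most `θ`, so it cannot
cross a level in `[-x, x]`. -/
theorem AgreeUpTo.add_small {ι : Type*} [Fintype ι] {F : Set (ι → ℤ)} {x θ : ℤ} {s r v : ι → ℤ}
    (h : AgreeUpTo F x s r) (hv : ∀ a ∈ F, |a ⬝ᵥ s| ≤ x + θ → a ⬝ᵥ v = 0)
    (hθ : ∀ a ∈ F, |a ⬝ᵥ v| ≤ θ) : AgreeUpTo F x (s + v) r := by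
  intro a ha c hc
  rw [← h a ha c hc, dotProduct_add]
  by_cases hsmall : |a ⬝ᵥ s| ≤ x + θ
  · rw [hv a ha hsmall, add_zero]
  · have h1 := abs_le.mp (hθ a ha)
    have h2 := abs_le.mp hc
    rcases lt_abs.mp (not_le.mp hsmall) with h3 | h3
    · constructor <;> intro <;> linarith
    · constructor <;> intro <;> linarith

theorem exists_bounded_agreeUpTo {d x : ℕ} (hx : 1 ≤ x) (F : Set (Fin d → ℤ))
    (hF : ∀ a ∈ F, ∀ i, |a i| ≤ x) (hunit : ∀ i, Pi.single i 1 ∈ F) (r : Fin d → ℤ) :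
    ∃ s : Fin d → ℤ, AgreeUpTo F x s r ∧
      ∀ i, |s i| ≤ d.factorial * largeThreshold d x ^ d := by
  let wt : (Fin d → ℤ) → Lex (Fin d → ℕ) := fun s => toLex fun i => (s i).natAbs
  obtain ⟨s, hs, hmin⟩ := (InvImage.wf wt wellFounded_lt).has_min {s | AgreeUpTo F x s r}
    ⟨r, fun a _ c _ => Iff.rfl⟩
  refine ⟨s, hs, ?_⟩
  -- Bounds `|a ⬝ᵥ v|` for `a ∈ F` and `v` from Siegel's lemma.
  let θ : ℤ := d * (x * ((d * x : ℕ) : ℤ) ^ d)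
  have hθ : 0 ≤ θ := by positivity
  let T : Set (Fin d → ℤ) := {a | a ∈ F ∧ |a ⬝ᵥ s| ≤ x + θ}
  rcases exists_small_annihilator_or_nonsingular T hx fun a ha => hF a ha.1 with
    ⟨v, hv0, hvT, hvb⟩ | ⟨M, hdet, hM⟩
  · exfalso
    rw [Fintype.card_fin] at hvb
    have hvθ : ∀ a ∈ F, |a ⬝ᵥ v| ≤ θ := fun a ha => by
      simpa [θ] using abs_dotProduct_le (hF a ha) hvb
    have hplus : AgreeUpTo F x (s + v) r :=
      hs.add_small (fun a ha h => hvT a ⟨ha, h⟩) hvθ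
    have hminus : AgreeUpTo F x (s + -v) r :=
      hs.add_small (fun a ha h => by rw [dotProduct_neg, hvT a ⟨ha, h⟩, neg_zero])
        fun a ha => by rw [dotProduct_neg, abs_neg]; exact hvθ a ha
    have hne : {i | v i ≠ 0}.Nonempty := by
      by_contra hemp
      exact hv0 (funext fun i => by_contra fun hi => hemp ⟨i, hi⟩)
    obtain ⟨i, hi, hfirst⟩ := wellFounded_lt.has_min {i | v i ≠ 0} hne
    have hzero : ∀ j < i, v j = 0 := fun j hj => by_contra fun h => hfirst j h hj
    have hbig : |v i| < |s i| := by
      -- Otherwise the unit functional at `i` lies in `T`, forcing `v i = 0`.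
      have h1 : x + θ < |s i| := by
        by_contra hcon
        refine hi ?_
        have := hvT (Pi.single i 1) ⟨hunit i, by simpa using hcon⟩
        simpa using this
      have h2 := hvθ _ (hunit i)
      rw [single_dotProduct, one_mul] at h2
      linarith
    have hlt : (s i + v i).natAbs < (s i).natAbs ∨ (s i + -v i).natAbs < (s i).natAbs := by
      have hi' : v i ≠ 0 := hi
      rcases abs_cases (v i) with h | h <;> rcases abs_cases (s i) with h' | h' <;> omega
    rcases hlt with h | h
    · exact hmin _ hplus ⟨i, fun j hj => by simp [wt, hzero j hj], h⟩
    · exact hmin _ hminus ⟨i, fun j hj => by simp [wt, hzero j hj], h⟩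
  · intro i
    have := abs_le_of_mulVec_bounded M hdet s (y := largeThreshold d x)
      (fun k j => (hF _ (hM k).1 j).trans (le_add_of_nonneg_right hθ)) (fun k => (hM k).2) i
    simpa using this

theorem intSize_bound {d S : ℕ} (hd : 1 ≤ d) (hS : d ≤ S) {z : ℤ}
    (hz : |z| ≤ d.factorial * largeThreshold d (2 ^ S) ^ d) :
    intSize z ≤ 18 * S ^ 4 := by
  have hd2 : d ≤ 2 ^ S := hS.trans Nat.lt_two_pow_self.le
  have hdx : d * 2 ^ S ≤ 2 ^ (2 * S) := by
    rw [two_mul, pow_add]; gcongr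
  have hpow : (d * 2 ^ S) ^ d ≤ 2 ^ (2 * S * d) := by
    rw [pow_mul]; gcongr
  have hθ : 2 ^ S + d * (2 ^ S * (d * 2 ^ S) ^ d) ≤ 2 ^ (2 * S * d + 2 * S + 1) := by
    have h1 : d * (2 ^ S * (d * 2 ^ S) ^ d) ≤ 2 ^ (2 * S * d + 2 * S) := by
      rw [← mul_assoc, pow_add, mul_comm (2 ^ (2 * S * d))]; gcongr
    have h2 : 2 ^ S ≤ 2 ^ (2 * S * d + 2 * S) := by gcongr <;> omega
    rw [pow_succ]; omega
  have hfac : d.factorial ≤ 2 ^ (S * d) := by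
    rw [pow_mul]
    exact (Nat.factorial_le_pow d).trans (by gcongr)
  have hz' : z.natAbs ≤ d.factorial * (2 ^ S + d * (2 ^ S * (d * 2 ^ S) ^ d)) ^ d := by
    zify
    simpa [largeThreshold] using hz
  have hb : z.natAbs ≤ 2 ^ (S * d + (2 * S * d + 2 * S + 1) * d) := by
    refine hz'.trans ?_
    rw [pow_add, pow_mul 2 (_ + 1) d]; gcongr
  refine Nat.clog_le_of_le_pow ?_
  -- The final `+ 1` absorbs the `|z| + 1` in `intSize`. With `d ≤ S` the left side is at most `7 *
  -- S ^ 4`, so 18 is generous.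
  have hle : S * d + (2 * S * d + 2 * S + 1) * d + 1 ≤ 18 * S ^ 4 := by
    have hS1 : 1 ≤ S := hd.trans hS
    calc S * d + (2 * S * d + 2 * S + 1) * d + 1
        ≤ S * S + (2 * S * S + 2 * S + 1) * S + 1 := by gcongr
      _ ≤ 18 * S ^ 4 := by
        have h2 : S ≤ S ^ 4 := Nat.le_self_pow (by norm_num) S
        have h3 : S ^ 2 ≤ S ^ 4 := Nat.pow_le_pow_right hS1 (by norm_num)
        have h4 : S ^ 3 ≤ S ^ 4 := Nat.pow_le_pow_right hS1 (by norm_num)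
        nlinarith
  refine le_trans ?_ (Nat.pow_le_pow_right (by norm_num) hle)
  rw [pow_succ]
  have := Nat.one_le_two_pow (n := S * d + (2 * S * d + 2 * S + 1) * d)
  omega

end BoundedIntegerPoints
-- Semantics of the threshold formulas
namespace PropForm

variable {V : Type*} {κ : V → Bool}

theorem sat_imp {φ ψ : PropForm V} : Sat κ (imp φ ψ) ↔ (Sat κ φ → Sat κ ψ) := by
  simp only [imp, Sat]
  tauto

theorem sat_listConj {l : List (PropForm V)} : Sat κ (listConj l) ↔ ∀ φ ∈ l, Sat κ φ := by
  induction l with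
  | nil => simp [listConj, top, Sat]
  | cons φ l ih => simp [listConj, Sat, ih]

theorem sat_listDisj {l : List (PropForm V)} : Sat κ (listDisj l) ↔ ∃ φ ∈ l, Sat κ φ := by
  induction l with
  | nil => simp [listDisj, Sat]
  | cons φ l ih =>
    simp only [listDisj, or, Sat, ih, List.mem_cons, exists_eq_or_imp]
    rw [not_and_or, not_not, not_not]

theorem sat_bigConj {ι : Type*} {s : Finset ι} {f : ι → PropForm V} :
    Sat κ (bigConj s f) ↔ ∀ j ∈ s, Sat κ (f j) := by
  simp [bigConj, sat_listConj]

theorem sat_bigDisj {ι : Type*} {s : Finset ι} {f : ι → PropForm V} :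
    Sat κ (bigDisj s f) ↔ ∃ j ∈ s, Sat κ (f j) := by
  simp [bigDisj, sat_listDisj]

open Classical in
/-- The formula `∑ i, r i • φ i ≥ k` holds iff the coefficients of the true `φ i` sum to at least
`k`. -/
theorem sat_sumGe {ι : Type*} [Fintype ι] [DecidableEq ι] {r : ι → ℤ} {φ : ι → PropForm V}
    {k : ℤ} : Sat κ (sumGe r φ k) ↔ k ≤ ∑ j with Sat κ (φ j), r j := by
  simp only [sumGe, sat_bigConj, sat_bigDisj, sat_imp, Finset.mem_filter, Finset.mem_univ,
    true_and, Finset.mem_compl]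
  constructor
  · intro h
    by_contra! hlt
    obtain ⟨j, hj, hs⟩ := h (Finset.univ.filter fun j => Sat κ (φ j)) hlt (by simp)
    exact hj (by simpa using hs)
  · intro h J hJ hsat
    by_contra! hnone
    have hJeq : (Finset.univ.filter fun j => Sat κ (φ j)) = J := by
      ext j
      simp only [Finset.mem_filter, Finset.mem_univ, true_and]
      exact ⟨fun hj => by_contra fun hnot => hnone j hnot hj, hsat j⟩
    rw [hJeq] at h
    exact absurd hJ (not_lt.mpr h)

theorem equivalent_iff {φ ψ : PropForm V} :
    Equivalent φ ψ ↔ ∀ κ : V → Bool, Sat κ φ ↔ Sat κ ψ := by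
  simp only [Equivalent, Entails, Tautology, sat_imp]
  exact ⟨fun h κ => ⟨h.1 κ, h.2 κ⟩, fun h => ⟨fun κ => (h κ).1, fun κ => (h κ).2⟩⟩

end PropForm

/-! ### Clearing denominators with control of bit sizes -/

theorem natAbs_le_two_pow_intSize (z : ℤ) : z.natAbs ≤ 2 ^ intSize z :=
  (Nat.le_succ _).trans (Nat.le_pow_clog (by norm_num) _)

theorem den_le_two_pow_intSize (q : ℚ) : q.den ≤ 2 ^ intSize (q.den : ℤ) :=
  natAbs_le_two_pow_intSize (q.den : ℤ)

theorem exists_int_eq_mul_of_den_dvd {q : ℚ} {D : ℕ} (h : q.den ∣ D) :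
    ∃ z : ℤ, (z : ℚ) = D * q ∧ z.natAbs ≤ 2 ^ intSize q.num * D := by
  obtain ⟨k, rfl⟩ := h
  refine ⟨q.num * k, ?_, ?_⟩
  · push_cast
    conv_lhs => rw [← Rat.mul_den_eq_num q]
    ring
  · rw [Int.natAbs_mul, Int.natAbs_natCast]
    exact Nat.mul_le_mul (natAbs_le_two_pow_intSize _) (Nat.le_mul_of_pos_left k q.den_pos)

namespace RatIneq

open Matrix

variable {ι : Type*} [Fintype ι]

theorem three_mul_card_lt_size (W : RatIneq ι) : 3 * Fintype.card ι + 2 < W.size := by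
  have hden : ∀ q : ℚ, 2 ≤ ratSize q := fun q => by
    have : 1 ≤ intSize (q.den : ℤ) :=
      Nat.clog_pos (by norm_num) (by have := q.den_pos; simp; omega)
    unfold ratSize
    omega
  have h1 := hden W.rhs
  have h2 : Fintype.card ι * 2 ≤ ∑ i, ratSize (W.coeff i) := by
    have := Finset.card_nsmul_le_sum Finset.univ (fun i => ratSize (W.coeff i)) 2
      fun i _ => hden _
    simpa using this
  unfold size
  omega

/-- Over the integers, a rational inequality is a lower bound, or the negation of a lower bound,
on an integer functional with coefficients of at most `W.size` bits. -/
theorem exists_integer_form (W : RatIneq ι) :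
    ∃ (w : ι → ℤ) (k : ℤ), (∀ i, |w i| ≤ 2 ^ W.size) ∧ |k| ≤ 2 ^ W.size ∧
      ((∀ z, W.IsSol z ↔ k ≤ w ⬝ᵥ z) ∨ ∀ z, W.IsSol z ↔ ¬ k ≤ w ⬝ᵥ z) := by
  classical
  let D : ℕ := W.rhs.den * ∏ i, (W.coeff i).den
  have hD : 0 < D := Nat.mul_pos W.rhs.den_pos (Finset.prod_pos fun i _ => (W.coeff i).den_pos)
  have hDle : D ≤ 2 ^ (intSize (W.rhs.den : ℤ) + ∑ i, intSize ((W.coeff i).den : ℤ)) := by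
    rw [pow_add, ← Finset.prod_pow_eq_pow_sum]
    exact Nat.mul_le_mul (den_le_two_pow_intSize _)
      (Finset.prod_le_prod' fun i _ => den_le_two_pow_intSize _)
  choose w hw hwb using fun i => exists_int_eq_mul_of_den_dvd (q := W.coeff i) (D := D)
    (Dvd.dvd.mul_left (Finset.dvd_prod_of_mem (fun i => (W.coeff i).den) (Finset.mem_univ i)) _)
  obtain ⟨c, hc, hcb⟩ := exists_int_eq_mul_of_den_dvd (q := W.rhs) (D := D) (Nat.dvd_mul_right _ _)
  have hsum : ∀ i, intSize (W.coeff i).num + ∑ j, intSize ((W.coeff j).den : ℤ)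
      ≤ ∑ j, ratSize (W.coeff j) := fun i => by
    have h1 : intSize (W.coeff i).num ≤ ∑ j, intSize (W.coeff j).num :=
      Finset.single_le_sum (f := fun j => intSize (W.coeff j).num) (fun _ _ => Nat.zero_le _)
        (Finset.mem_univ i)
    have h2 : ∑ j, (intSize (W.coeff j).num + intSize ((W.coeff j).den : ℤ))
        ≤ ∑ j, ratSize (W.coeff j) :=
      Finset.sum_le_sum fun j _ => by unfold ratSize; omega
    rw [Finset.sum_add_distrib] at h2
    omega
  have hsum' : ∑ j, intSize ((W.coeff j).den : ℤ) ≤ ∑ j, ratSize (W.coeff j) :=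
    Finset.sum_le_sum fun j _ => by unfold ratSize; omega
  have hw' : ∀ i, |w i| ≤ 2 ^ W.size := fun i => by
    have : (w i).natAbs ≤ 2 ^ W.size := by
      refine (hwb i).trans ((Nat.mul_le_mul_left _ hDle).trans ?_)
      rw [← pow_add]
      refine Nat.pow_le_pow_right (by norm_num) ?_
      have := hsum i
      unfold size
      rw [ratSize]
      omega
    zify at this
    exact this
  -- The spare unit is for `≤` and `>`, whose integer level is `c + 1`.
  have hc' : |c| + 1 ≤ 2 ^ W.size := by
    have : c.natAbs + 1 ≤ 2 ^ W.size := by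
      have h1 : c.natAbs ≤ 2 ^ (W.size - 1) := by
        refine hcb.trans ((Nat.mul_le_mul_left _ hDle).trans ?_)
        rw [← pow_add]
        refine Nat.pow_le_pow_right (by norm_num) ?_
        unfold size
        rw [ratSize]
        omega
      have h2 : W.size = W.size - 1 + 1 := by
        have := W.three_mul_card_lt_size
        omega
      have h3 := Nat.one_le_two_pow (n := W.size - 1)
      rw [h2, pow_succ]
      omega
    zify at this
    exact this
  have hDq : (0 : ℚ) < D := by exact_mod_cast hD
  have hdot : ∀ z : ι → ℤ, ((w ⬝ᵥ z : ℤ) : ℚ) = D * ∑ i, W.coeff i * (z i : ℚ) := fun z => by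
    simp only [dotProduct, Int.cast_sum, Int.cast_mul, hw, Finset.mul_sum, mul_assoc]
  have hlt : ∀ z : ι → ℤ, ∑ i, W.coeff i * (z i : ℚ) < W.rhs ↔ w ⬝ᵥ z < c := fun z => by
    rw [← Int.cast_lt (R := ℚ), hdot, hc, mul_lt_mul_iff_right₀ hDq]
  have hle : ∀ z : ι → ℤ, ∑ i, W.coeff i * (z i : ℚ) ≤ W.rhs ↔ w ⬝ᵥ z ≤ c := fun z => by
    rw [← Int.cast_le (R := ℚ), hdot, hc, mul_le_mul_iff_right₀ hDq]
  have hc1 : |c + 1| ≤ 2 ^ W.size := (abs_add_le c 1).trans (by simpa using hc')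
  have hc0 : |c| ≤ 2 ^ W.size := by linarith
  rcases hop : W.op with _ | _ | _ | _
  · refine ⟨w, c, hw', hc0, Or.inr fun z => ?_⟩
    rw [IsSol, hop, CompOp.Rel, hlt, not_le]
  · refine ⟨w, c + 1, hw', hc1, Or.inr fun z => ?_⟩
    rw [IsSol, hop, CompOp.Rel, hle, not_le, Int.lt_add_one_iff]
  · refine ⟨w, c + 1, hw', hc1, Or.inl fun z => ?_⟩
    rw [IsSol, hop, CompOp.Rel, gt_iff_lt, ← not_le, hle, not_le, Int.add_one_le_iff]
  · refine ⟨w, c, hw', hc0, Or.inl fun z => ?_⟩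
    rw [IsSol, hop, CompOp.Rel, ge_iff_le, ← not_lt, hlt, not_lt]

end RatIneq

/-! ### Choosing the functionals -/

section SmallThresholds

open Matrix

theorem sign_eq_of_le_iff {y z : ℤ} (h0 : 0 ≤ y ↔ 0 ≤ z) (h1 : 1 ≤ y ↔ 1 ≤ z) :
    y.sign = z.sign := by
  rcases lt_trichotomy y 0 with h | h | h <;> rcases lt_trichotomy z 0 with h' | h' | h' <;>
    first
      | omega
      | simp [Int.sign_eq_neg_one_of_neg, Int.sign_eq_one_of_pos, h, h']

/-- Coefficients and threshold of `∑ i, r i • a i ≥ r 0` can be made small while preserving signs,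
propositional equivalence and all lower bounds of moderate size on a given functional. -/
theorem exists_small_equivalent {V : Type*} {n : ℕ} (a : Fin n → V) (r w : Fin (n + 1) → ℤ)
    {S : ℕ} (hS : n + 1 ≤ S) (hw : ∀ i, |w i| ≤ 2 ^ S) :
    ∃ s : Fin (n + 1) → ℤ, (∀ k : ℤ, |k| ≤ 2 ^ S → (k ≤ w ⬝ᵥ s ↔ k ≤ w ⬝ᵥ r)) ∧
      (∀ i, (s i).sign = (r i).sign) ∧
      (PropForm.sumGe (fun i : Fin n => s i.succ) (fun i => .var (a i)) (s 0)).Equivalent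
        (PropForm.sumGe (fun i : Fin n => r i.succ) (fun i => .var (a i)) (r 0)) ∧
      ∀ i, intSize (s i) ≤ 18 * S ^ 4 := by
  classical
  -- The entry `-1` moves the threshold `z 0` to the left, so only level `0` has to be tested.
  let χ : Finset (Fin n) → Fin (n + 1) → ℤ := fun J => Fin.cons (-1) fun i => if i ∈ J then 1 else 0
  have hχ : ∀ J (z : Fin (n + 1) → ℤ), χ J ⬝ᵥ z = -z 0 + ∑ j ∈ J, z j.succ := fun J z => by
    simp [χ, dotProduct, Fin.sum_univ_succ]
  let F : Set (Fin (n + 1) → ℤ) := insert w (Set.range χ ∪ Set.range fun i => Pi.single i 1)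
  have hone : (1 : ℤ) ≤ 2 ^ S := one_le_pow₀ (by norm_num)
  have hF : ∀ b ∈ F, ∀ i, |b i| ≤ ((2 ^ S : ℕ) : ℤ) := by
    push_cast
    rintro b (rfl | ⟨J, rfl⟩ | ⟨j, rfl⟩) i
    · exact hw i
    · refine le_trans ?_ hone
      refine Fin.cases (by simp [χ]) (fun i => ?_) i
      simp only [χ, Fin.cons_succ]
      split_ifs <;> simp
    · refine le_trans ?_ hone
      by_cases h : i = j
      · subst h; simp
      · simp [h]
  have hunit : ∀ i, Pi.single i 1 ∈ F := fun i => Or.inr (Or.inr ⟨i, rfl⟩)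
  obtain ⟨s, hs, hb⟩ := exists_bounded_agreeUpTo Nat.one_le_two_pow F hF hunit r
  have hs' : ∀ b ∈ F, ∀ k : ℤ, |k| ≤ 2 ^ S → (k ≤ b ⬝ᵥ s ↔ k ≤ b ⬝ᵥ r) := fun b hb k hk =>
    hs b hb k (by exact_mod_cast hk)
  refine ⟨s, hs' w (Or.inl rfl), fun i => ?_, ?_, fun i => intSize_bound (by omega) hS (hb i)⟩
  -- Levels `0` and `1` of a coordinate determine its sign.
  · have h := hs' _ (hunit i)
    simp only [single_dotProduct, one_mul] at h
    exact sign_eq_of_le_iff (h 0 (by simp)) (h 1 (by simpa using hone))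
  · rw [PropForm.equivalent_iff]
    intro κ
    rw [PropForm.sat_sumGe, PropForm.sat_sumGe]
    have h := hs' _ (Or.inr (Or.inl ⟨Finset.univ.filter fun j =>
      PropForm.Sat κ (PropForm.var (a j)), rfl⟩)) 0 (by simp)
    rw [hχ, hχ] at h
    constructor <;> intro h'
    · linarith [h.1 (by linarith)]
    · linarith [h.2 (by linarith)]

end SmallThresholds

theorem mainTheorem10 {V : Type*} {n : ℕ} (a : Fin n → V) (r : Fin (n + 1) → ℤ) :
    -- inequalities `∑ i ∈ {1, …, n}, u i * x i op u 0` in which `x 0` does not occur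
    (∀ W : RatIneq (Fin n), W.IsSol (fun i => r i.succ) →
      ∃ s : Fin (n + 1) → ℤ,
        W.IsSol (fun i => s i.succ) ∧
        (∀ i, (s i).sign = (r i).sign) ∧
        (PropForm.sumGe (fun i : Fin n => s i.succ) (fun i => .var (a i)) (s 0)).Equivalent
          (PropForm.sumGe (fun i : Fin n => r i.succ) (fun i => .var (a i)) (r 0)) ∧
        ∀ i, intSize (s i) ≤ 18 * W.size ^ 4) ∧
    -- inequalities in all the variables `x 0, …, x n`
    (∀ W : RatIneq (Fin (n + 1)), W.IsSol r →
      ∃ s : Fin (n + 1) → ℤ,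
        W.IsSol s ∧
        (∀ i, (s i).sign = (r i).sign) ∧
        (PropForm.sumGe (fun i : Fin n => s i.succ) (fun i => .var (a i)) (s 0)).Equivalent
          (PropForm.sumGe (fun i : Fin n => r i.succ) (fun i => .var (a i)) (r 0)) ∧
        ∀ i, intSize (s i) ≤ 18 * W.size ^ 4) := by
  constructor
  · intro W hW
    obtain ⟨w, k, hw, hk, hsol⟩ := W.exists_integer_form
    have hcard := W.three_mul_card_lt_size
    rw [Fintype.card_fin] at hcard
    have hdot : ∀ z : Fin (n + 1) → ℤ,
        Matrix.vecCons 0 w ⬝ᵥ z = w ⬝ᵥ fun i => z i.succ := fun z => by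
      simp [dotProduct, Fin.sum_univ_succ]
    -- Coefficient `0` at `x 0` reduces this case to a functional in all variables.
    obtain ⟨s, hs, hsign, heq, hsize⟩ := exists_small_equivalent a r (Matrix.vecCons 0 w)
      (S := W.size) (by omega) (Fin.cases (by simp) fun i => by simpa using hw i)
    have h := hs k hk
    rw [hdot, hdot] at h
    refine ⟨s, ?_, hsign, heq, hsize⟩
    rcases hsol with hsol | hsol
    · rwa [hsol, h, ← hsol]
    · rwa [hsol, h, ← hsol]
  · intro W hW
    obtain ⟨w, k, hw, hk, hsol⟩ := W.exists_integer_form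
    have hcard := W.three_mul_card_lt_size
    rw [Fintype.card_fin] at hcard
    obtain ⟨s, hs, hsign, heq, hsize⟩ := exists_small_equivalent a r w (S := W.size) (by omega) hw
    refine ⟨s, ?_, hsign, heq, hsize⟩
    rcases hsol with hsol | hsol
    · rwa [hsol, hs k hk, ← hsol]
    · rwa [hsol, hs k hk, ← hsol]
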